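/- Let $p$ be an odd prime, let $a\in\mathbb{F}_p$ with $a\neq 0,1,\tfrac12$, and let $\mathcal{R}^{(2)}=\mathbb{F}_p(t)\bigl(\sqrt{t},\sqrt{1-t},\sqrt{1+\sqrt{t}}\bigr)$, formed inside an algebraic closure of the rational function field $\mathbb{F}_p(t)$, with any choice of the three square roots (the root $\sqrt t$ in the third generator being the first generator). Let $n_a$ be the number of prime ideals lying above $(t-a)\subset\mathbb{F}_p[t]$ in the integral closure of $\mathbb{F}_p[t]$ in $\mathcal{R}^{(2)}$. Let $A_2(x)\in\mathbb{F}_p[x]$ be the polynomial $$A_2(x)=\tfrac12\Bigl((1-\sqrt{x})^{\frac{p-1}{2}}+(1+\sqrt{x})^{\frac{p-1}{2}}\Bigr)$$ (the right-hand side is invariant under $\sqrt{x}\mapsto-\sqrt{x}$, hence is a polynomial in $x$). Then $n_a$ is determined by the value of $A_2(a)$: one of the following three cases always holds, and $$n_a=\begin{cases}8 & \text{if } A_2(a)=1,\\ 4 & \text{if } A_2(a)=-1,\ \text{or } A_2(a)=0,\ \text{or } A_2(a)^2=\frac{1}{1-a},\\ 2 & \text{if } A_2(a)^2=\frac{a}{1-a}.\end{cases}$$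 -/

import Mathlib

open Polynomial

noncomputable section

/-- The element `ε_ℓ = ∏_{i=1}^{ℓ-1} (1 - ζ^i s)^i`, where `ζ` stands for a primitive `ℓ`-th root of
unity and `s` for an `ℓ`-th root of `t`. For `ℓ = 2` (so `ζ = -1`) it is `1 + √t`. -/
def heisenbergEps {L : Type*} [Field L] (ℓ : ℕ) (ζ s : L) : L :=
  ∏ i ∈ Finset.Icc 1 (ℓ - 1), (1 - ζ ^ i * s) ^ i

/-- `x = t^{1/ℓ}`, `y = (1-t)^{1/ℓ}` and `z = ε_ℓ(t)^{1/ℓ}` in a fixed algebraic closure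
of the rational function field `k(t)`. -/
structure IsHeisenbergRoots (k : Type*) [Field k] (ℓ : ℕ) (ζ : k)
    (x y z : AlgebraicClosure (RatFunc k)) : Prop where
  pow_x : x ^ ℓ = algebraMap (RatFunc k) (AlgebraicClosure (RatFunc k)) RatFunc.X
  pow_y : y ^ ℓ = 1 - algebraMap (RatFunc k) (AlgebraicClosure (RatFunc k)) RatFunc.X
  pow_z : z ^ ℓ = heisenbergEps ℓ (algebraMap k (AlgebraicClosure (RatFunc k)) ζ) x

theorem exists_isHeisenbergRoots (k : Type*) [Field k] (ℓ : ℕ) (hℓ : 0 < ℓ) (ζ : k) :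
    ∃ x y z, IsHeisenbergRoots k ℓ ζ x y z := by
  obtain ⟨x, hx⟩ := IsAlgClosed.exists_pow_nat_eq
    (algebraMap (RatFunc k) (AlgebraicClosure (RatFunc k)) RatFunc.X) hℓ
  obtain ⟨y, hy⟩ := IsAlgClosed.exists_pow_nat_eq
    (1 - algebraMap (RatFunc k) (AlgebraicClosure (RatFunc k)) RatFunc.X) hℓ
  obtain ⟨z, hz⟩ := IsAlgClosed.exists_pow_nat_eq
    (heisenbergEps ℓ (algebraMap k (AlgebraicClosure (RatFunc k)) ζ) x) hℓ
  exact ⟨x, y, z, hx, hy, hz⟩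

/-- The extension `k(t)(x, y, z)` of `k(t)`. When `x`, `y`, `z` are the roots of
`IsHeisenbergRoots k ℓ ζ x y z`, this is the mod `ℓ` Heisenberg extension `R^(ℓ)`. -/
def heisenbergField (k : Type*) [Field k] (x y z : AlgebraicClosure (RatFunc k)) :
    IntermediateField (RatFunc k) (AlgebraicClosure (RatFunc k)) :=
  IntermediateField.adjoin (RatFunc k) {x, y, z}

/-- The number of primes above `(t - a)` in an extension `R` of `k(t)`: the number of prime ideals,
of the integral closure of `k[t]` in `R`, that lie over the ideal `(t - a)` of `k[t]`. -/
def numPrimesAbove {k : Type*} [Field k]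
    (R : IntermediateField (RatFunc k) (AlgebraicClosure (RatFunc k))) (a : k) : ℕ :=
  (Ideal.primesOver (Ideal.span {(X - C a : k[X])}) (integralClosure k[X] R)).ncard

/-- The polynomial `A_2(x) = ½ ((1 - √x)^((p-1)/2) + (1 + √x)^((p-1)/2))` over `F_p`. It is obtained
from `½ ((1 - s)^((p-1)/2) + (1 + s)^((p-1)/2))`, a polynomial in `s²`, by substituting `x` for
`s²` (`Polynomial.contract 2`); `expand_polyA2` and `aeval_polyA2` justify this. -/
def polyA2 (p : ℕ) [Fact p.Prime] : (ZMod p)[X] :=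
  contract 2 (C (1 / 2 : ZMod p) * ((1 - X) ^ ((p - 1) / 2) + (1 + X) ^ ((p - 1) / 2)))

theorem expand_polyA2 (p : ℕ) [Fact p.Prime] (hp : p ≠ 2) :
    expand (ZMod p) 2 (polyA2 p) =
      C (1 / 2 : ZMod p) * ((1 - X) ^ ((p - 1) / 2) + (1 + X) ^ ((p - 1) / 2)) := by
  have h2 : (2 : ZMod p) ≠ 0 := by
    have : Fact (2 < p) := ⟨lt_of_le_of_ne (Fact.out : p.Prime).two_le (Ne.symm hp)⟩
    have := ZMod.neg_one_ne_one (n := p)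
    intro h
    exact this (by linear_combination -h)
  unfold polyA2
  set f : (ZMod p)[X] :=
    C (1 / 2 : ZMod p) * ((1 - X) ^ ((p - 1) / 2) + (1 + X) ^ ((p - 1) / 2)) with hf
  have hsymm : f.comp (-X) = f := by
    simp [hf, add_comm, ← sub_eq_add_neg]
  ext n
  rw [coeff_expand two_pos]
  split_ifs with hn
  · rw [coeff_contract two_ne_zero, Nat.div_mul_cancel hn]
  · have hodd : Odd n := by
      rwa [← Nat.not_even_iff_odd, even_iff_two_dvd]
    have hc := congrArg (fun g => coeff g n) hsymm
    have hX : (-X : (ZMod p)[X]) = C (-1) * X := by simp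
    simp only [hX, comp_C_mul_X_coeff, hodd.neg_one_pow] at hc
    have : (2 : ZMod p) * f.coeff n = 0 := by linear_combination -hc
    exact ((mul_eq_zero.mp this).resolve_left h2).symm

/-- For every square root `s` of `a`, in any extension of `F_p`, the value of `A_2` at `a`
is `½ ((1 - s)^((p-1)/2) + (1 + s)^((p-1)/2))`. -/
theorem aeval_polyA2 (p : ℕ) [Fact p.Prime] (hp : p ≠ 2) {L : Type*} [Field L]
    [Algebra (ZMod p) L] (a : ZMod p) (s : L) (hs : s ^ 2 = algebraMap (ZMod p) L a) :
    algebraMap (ZMod p) L ((polyA2 p).eval a) =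
      1 / 2 * ((1 - s) ^ ((p - 1) / 2) + (1 + s) ^ ((p - 1) / 2)) := by
  have h := congrArg (aeval s) (expand_polyA2 p hp)
  rw [expand_aeval, hs, aeval_algebraMap_apply] at h
  have h2 : algebraMap (ZMod p) L 2 = 2 := map_ofNat _ 2
  simpa [h2] using h

end

/-!
Put `w = y / z`. Then `w² = 1 - x`, so the field `R` generated by the three square roots is
generated over `𝔽_p(t)` by a point `(z, w)` of the circle `z² + w² = 2`, where `t = (z² - 1)²`, and
`R` is the splitting field of `(X² - 1)² - t`, whose roots are `±z` and `±w`. The Galois group acts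
on `(z, w)` by symmetries of the square (`IsDihedralPair`). Because none of `t`, `1 - t` and
`t (1 - t)` is a square in `𝔽_p(t)`, it is the whole dihedral group of order eight
(`card_gal_heisenbergField`).

Let `Q` be a prime above `(t - a)`. Modulo `Q` the four elements `±z`, `±w` stay distinct, as
`a ≠ 0, 1`. Hence the inertia group is trivial, the decomposition group is generated by a Frobenius
element `φ`, and the number of primes above `(t - a)` is `8 / orderOf φ`
(`IsArithFrobAt.ncard_primesOver_mul_orderOf`).

Finally, `φ` can be read off from `A₂(a)`. In `A₂(a) = ((1 - s)^((p-1)/2) + (1 + s)^((p-1)/2)) / 2`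
one may take for `s` the residue of `x = z² - 1`; then `1 + s` and `1 - s` are the squares of the
residues `ζ` and `ω` of `z` and `w`, and `2 ζ ω A₂(a) = ζ ω^p + ω ζ^p` (`two_mul_mul_polyA2`), where
`ζ^p` and `ω^p` are the residues of `φ z` and `φ w`. Each of the eight symmetries of the square then
gives the order of `φ` together with the value of `A₂(a)` or of its square
(`IsDihedralPair.orderOf_frobenius_and_eval_polyA2`). For `a ≠ 1/2` the resulting conditions on
`A₂(a)` are mutually exclusive for different orders.
-/

open scoped Pointwise

/-! ### Decomposition groups generated by Frobenius -/

section Frobenius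

variable {A B G : Type*} [CommRing A] [CommRing B] [Algebra A B] [Group G] [Finite G]
  [MulSemiringAction G B] [SMulCommClass G A B] [Algebra.IsInvariant A B G]

attribute [local instance] Ideal.Quotient.field in
/-- At a prime with trivial inertia group and finite residue field, the decomposition group is
the Galois group of the residue extension, hence is generated by any Frobenius element. -/
theorem IsArithFrobAt.stabilizer_eq_zpowers {Q : Ideal B} [Q.IsPrime] [Finite (B ⧸ Q)]
    (hQ : Q.inertia G = ⊥) {φ : G} (hφ : IsArithFrobAt A φ Q) :
    MulAction.stabilizer G Q = Subgroup.zpowers φ := by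
  have hAB : Algebra.IsIntegral A B := Algebra.IsInvariant.isIntegral A B G
  have hQmax : Q.IsMaximal :=
    Ideal.Quotient.maximal_of_isField _ (Finite.isField_of_domain (B ⧸ Q))
  set P := Q.under A
  have : Finite (A ⧸ P) := .of_injective _ Ideal.algebraMap_quotient_injective
  have : P.IsMaximal := Ideal.isMaximal_comap_of_isIntegral_of_isMaximal Q
  have := Fintype.ofFinite (A ⧸ P)
  apply le_antisymm
  · intro σ hσ
    have hinj : Function.Injective (Ideal.Quotient.stabilizerHom Q P G) := by
      rw [← MonoidHom.ker_eq_bot_iff, ← (Subgroup.map_injective Subtype.val_injective).eq_iff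
        (f := Subgroup.map (Subgroup.subtype _)), Ideal.Quotient.map_ker_stabilizer_subtype,
        hQ, Subgroup.map_bot]
    have hfrob : Ideal.Quotient.stabilizerHom Q P G ⟨φ, hφ.mem_stabilizer⟩ =
        FiniteField.frobeniusAlgEquivOfAlgebraic (A ⧸ P) (B ⧸ Q) := by
      ext b
      obtain ⟨b, rfl⟩ := Ideal.Quotient.mk_surjective b
      have := hφ.mk_apply b
      rw [Nat.card_eq_fintype_card] at this
      exact this
    obtain ⟨n, hn⟩ := (FiniteField.bijective_frobeniusAlgEquivOfAlgebraic_pow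
      (A ⧸ P) (B ⧸ Q)).2 (Ideal.Quotient.stabilizerHom Q P G ⟨σ, hσ⟩)
    simp only [← hfrob, ← map_pow] at hn
    refine Subgroup.mem_zpowers_iff.2 ⟨n, ?_⟩
    simpa using congrArg Subtype.val (hinj hn)
  · simpa using hφ.mem_stabilizer

/-- The orbit-stabilizer formula for the primes over `P`, at a prime of trivial inertia. -/
theorem IsArithFrobAt.ncard_primesOver_mul_orderOf (P : Ideal A) {Q : Ideal B} [Q.IsPrime]
    [Q.LiesOver P] [Finite (B ⧸ Q)] (hQ : Q.inertia G = ⊥) {φ : G} (hφ : IsArithFrobAt A φ Q) :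
    (P.primesOver B).ncard * orderOf φ = Nat.card G := by
  rw [← Algebra.IsInvariant.orbit_eq_primesOver A B G P Q, ← Nat.card_zpowers,
    ← hφ.stabilizer_eq_zpowers hQ]
  simpa using Nat.card_congr (MulAction.orbitProdStabilizerEquivGroup G Q)

end Frobenius

/-! ### Dihedral pairs -/

/-- A pair `(z, w)` of elements of a ring with an action of `G` that lies on the circle
`z² + w² = 2` and on which `G` acts faithfully through the symmetries of the square: every
element of `G` maps `z` and `w` to `±z` and `±w`, or to `±w` and `±z`, with independent signs. -/
structure IsDihedralPair (G : Type*) {S : Type*} [Group G] [CommRing S] [MulSemiringAction G S]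
    (z w : S) : Prop where
  sq_add_sq : z ^ 2 + w ^ 2 = 2
  smul_cases (σ : G) : ((σ • z = z ∨ σ • z = -z) ∧ (σ • w = w ∨ σ • w = -w)) ∨
    ((σ • z = w ∨ σ • z = -w) ∧ (σ • w = z ∨ σ • w = -z))
  eq_one (σ : G) : σ • z = z → σ • w = w → σ = 1

namespace IsDihedralPair

variable {G S : Type*} [Group G] [CommRing S] [MulSemiringAction G S] {z w : S}

theorem ext (h : IsDihedralPair G z w) {σ τ : G} (hz : σ • z = τ • z) (hw : σ • w = τ • w) :
    σ = τ := by
  have := h.eq_one (τ⁻¹ * σ) (by simp [mul_smul, hz]) (by simp [mul_smul, hw])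
  exact (inv_mul_eq_one.1 this).symm

/-- The two rotations by a right angle have order four. -/
theorem orderOf_eq_four (h : IsDihedralPair G z w) (hz : 2 * z ≠ 0) {σ : G}
    (hσ : σ • z = w ∧ σ • w = -z ∨ σ • z = -w ∧ σ • w = z) : orderOf σ = 4 := by
  have h2 : σ ^ 2 • z = -z ∧ σ ^ 2 • w = -w := by
    rcases hσ with ⟨h1, h2⟩ | ⟨h1, h2⟩ <;> simp [pow_two, mul_smul, h1, h2]
  refine orderOf_eq_prime_pow (p := 2) (n := 1) (fun h1 ↦ hz ?_) (h.eq_one _ ?_ ?_)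
  · have := h2.1
    rw [show σ ^ 2 = 1 by simpa using h1, one_smul] at this
    linear_combination this
  all_goals
    rw [show σ ^ 2 ^ (1 + 1) = σ ^ 2 * σ ^ 2 by rw [← pow_add]; rfl]
    simp [mul_smul, h2]

theorem orderOf_eq_two (h : IsDihedralPair G z w) {σ : G} (h1 : σ ≠ 1)
    (hz : σ • σ • z = z) (hw : σ • σ • w = w) : orderOf σ = 2 :=
  orderOf_eq_prime (h.eq_one _ (by rw [pow_two, mul_smul, hz]) (by rw [pow_two, mul_smul, hw])) h1

theorem card_le [IsDomain S] (h : IsDihedralPair G z w) (hz : z ≠ 0) : Nat.card G ≤ 8 := by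
  classical
  let T : Finset (S × S) := {z, -z, w, -w} ×ˢ {z * w, -(z * w)}
  have hT : T.card ≤ 8 := by
    rw [Finset.card_product]
    exact Nat.mul_le_mul Finset.card_le_four Finset.card_le_two
  -- an element of `G` is determined by the images of `z` and of `z * w`
  let f (σ : G) : T := ⟨(σ • z, σ • (z * w)), by
    rw [smul_mul']
    rcases h.smul_cases σ with ⟨h1 | h1, h2 | h2⟩ | ⟨h1 | h1, h2 | h2⟩ <;>
      simp [T, h1, h2, mul_comm]⟩
  have hf : Function.Injective f := fun σ τ hστ ↦ by
    simp only [f, Subtype.mk.injEq, Prod.mk.injEq, smul_mul'] at hστ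
    refine h.ext hστ.1 (mul_left_cancel₀ ((smul_ne_zero_iff_ne τ).2 hz) ?_)
    rw [← hστ.2, hστ.1]
  calc Nat.card G ≤ Nat.card T := Nat.card_le_card_of_injective f hf
    _ ≤ 8 := by simpa using hT

/-- If none of `x = z² - 1`, `y = z * w` and `x * y` is fixed by `G`, then `G` is the full
symmetry group of the square. -/
theorem card_eq_eight [IsDomain S] [Finite G] (h : IsDihedralPair G z w) (h2 : (2 : S) ≠ 0)
    (hz : z ≠ 0) (hw : w ≠ 0) (hx : ∃ σ : G, σ • (z ^ 2 - 1) ≠ z ^ 2 - 1)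
    (hy : ∃ σ : G, σ • (z * w) ≠ z * w)
    (hxy : ∃ σ : G, σ • ((z ^ 2 - 1) * (z * w)) ≠ (z ^ 2 - 1) * (z * w)) :
    Nat.card G = 8 := by
  have hzz : -z ≠ z := fun h ↦ mul_ne_zero h2 hz (by linear_combination -h)
  have hww : -w ≠ w := fun h ↦ mul_ne_zero h2 hw (by linear_combination -h)
  have hw2 : w ^ 2 = 2 - z ^ 2 := by linear_combination h.sq_add_sq
  -- an element changing the signs of both `x` and `y` has order four
  obtain ⟨τ, hτ⟩ : ∃ τ : G, τ • z = w ∧ τ • w = -z ∨ τ • z = -w ∧ τ • w = z := by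
    obtain ⟨g, hg⟩ := hx
    obtain ⟨g', hg'⟩ := hy
    by_contra! hτ
    have key := hτ (g * g')
    have hg1 := hτ g
    have hg2 := hτ g'
    simp only [smul_sub, smul_pow', smul_one, smul_mul'] at hg hg'
    simp only [mul_smul] at key
    rcases h.smul_cases g with ⟨h1 | h1, h2 | h2⟩ | ⟨h1 | h1, h2 | h2⟩ <;>
    rcases h.smul_cases g' with ⟨h3 | h3, h4 | h4⟩ | ⟨h3 | h3, h4 | h4⟩ <;>
    simp [h1, h2, h3, h4, mul_comm] at hg hg' hg1 hg2 key
  obtain ⟨g, hg⟩ := hxy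
  -- an element fixing exactly one of `x` and `y` does not commute with it
  have hcomm : ¬ Commute g τ := by
    intro hc
    have hc : g • τ • z = τ • g • z := by rw [← mul_smul, ← mul_smul, hc.eq]
    simp only [smul_sub, smul_pow', smul_one, smul_mul'] at hg
    rcases h.smul_cases g with ⟨h1 | h1, h2 | h2⟩ | ⟨h1 | h1, h2 | h2⟩ <;>
    rcases hτ with ⟨h3, h4⟩ | ⟨h3, h4⟩ <;>
    simp [h1, h2, h3, h4, hzz, hww, hzz.symm, hww.symm] at hc hg <;>
    exact hg (by linear_combination -(z * w) * hw2)
  have h4 := h.orderOf_eq_four (mul_ne_zero h2 hz) hτ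
  have hdvd : 4 ∣ Nat.card G := h4 ▸ orderOf_dvd_natCard τ
  have hne : Nat.card G ≠ 4 := by
    intro hG
    have htop : Subgroup.zpowers τ = ⊤ :=
      Subgroup.eq_top_of_card_eq _ (by rw [Nat.card_zpowers, h4, hG])
    obtain ⟨n, hn⟩ := Subgroup.mem_zpowers_iff.1 (htop ▸ Subgroup.mem_top g)
    exact hcomm (hn ▸ (Commute.refl τ).zpow_left n)
  have := h.card_le hz
  have := Nat.card_pos (α := G)
  omega

/-- Inertia is trivial wherever `2`, `z * w` and `z² - w²` are nonzero, since then `z`, `-z`, `w` and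
`-w` remain distinct modulo `Q`. -/
theorem inertia_eq_bot (h : IsDihedralPair G z w) {Q : Ideal S} [Q.IsPrime] (h2 : 2 ∉ Q)
    (hzw : z * w ∉ Q) (hsub : z ^ 2 - w ^ 2 ∉ Q) : Q.inertia G = ⊥ := by
  have hz : 2 * z ∉ Q := fun hm ↦ ((Ideal.IsPrime.mem_or_mem ‹_› hm).resolve_left h2) |>
    fun hm ↦ hzw (Q.mul_mem_right _ hm)
  have hw : 2 * w ∉ Q := fun hm ↦ ((Ideal.IsPrime.mem_or_mem ‹_› hm).resolve_left h2) |>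
    fun hm ↦ hzw (Q.mul_mem_left _ hm)
  refine (Subgroup.eq_bot_iff_forall _).2 fun σ hσ ↦ ?_
  have h1 : σ • z - z ∈ Q := hσ z
  have h3 : σ • w - w ∈ Q := hσ w
  have mem {u v : S} (hu : u ∈ Q) (huv : u = v) : v ∈ Q := huv ▸ hu
  rcases h.smul_cases σ with ⟨hc | hc, hd | hd⟩ | ⟨hc | hc, -⟩
  · exact h.eq_one σ hc hd
  · exact absurd (mem (Q.neg_mem h3) (by rw [hd]; ring)) hw
  · exact absurd (mem (Q.neg_mem h1) (by rw [hc]; ring)) hz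
  · exact absurd (mem (Q.neg_mem h1) (by rw [hc]; ring)) hz
  · exact absurd (mem (Q.mul_mem_left (-(z + w)) h1) (by rw [hc]; ring)) hsub
  · exact absurd (mem (Q.mul_mem_left (w - z) h1) (by rw [hc]; ring)) hsub

end IsDihedralPair

/-! ### Frobenius elements and the values of `A₂` -/

section FrobeniusValue

variable {p : ℕ} [Fact p.Prime]

theorem ZMod.two_ne_zero_of_ne_two (hp : p ≠ 2) : (2 : ZMod p) ≠ 0 :=
  Ring.two_ne_zero (by rwa [ZMod.ringChar_zmod_n])

theorem two_ne_zero_of_algebra (hp : p ≠ 2) {κ : Type*} [Field κ] [Algebra (ZMod p) κ] :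
    (2 : κ) ≠ 0 := by
  have := (_root_.map_ne_zero (algebraMap (ZMod p) κ)).2 (ZMod.two_ne_zero_of_ne_two hp)
  rwa [map_ofNat] at this

/-- On the circle `ζ² + ω² = 2` the polynomial `A₂` measures the action of Frobenius: with
`s = ζ² - 1` its definition reads `A₂(s²) = (ω^(p-1) + ζ^(p-1)) / 2`. -/
theorem two_mul_mul_polyA2 (hp : p ≠ 2) {κ : Type*} [Field κ] [Algebra (ZMod p) κ] {a : ZMod p}
    {ζ ω : κ} (h : ζ ^ 2 + ω ^ 2 = 2) (ha : (ζ ^ 2 - 1) ^ 2 = algebraMap (ZMod p) κ a) :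
    2 * (ζ * ω) * algebraMap (ZMod p) κ ((polyA2 p).eval a) = ζ * ω ^ p + ω * ζ ^ p := by
  have h2 : (2 : κ) ≠ 0 := two_ne_zero_of_algebra hp
  have hodd : 2 * ((p - 1) / 2) + 1 = p := by
    have := (Fact.out : p.Prime).eq_two_or_odd
    omega
  have hpow (u : κ) : (u ^ 2) ^ ((p - 1) / 2) * u = u ^ p := by
    rw [← pow_mul, ← pow_succ, hodd]
  rw [aeval_polyA2 p hp a _ ha, show 1 - (ζ ^ 2 - 1) = ω ^ 2 by linear_combination -h,
    show 1 + (ζ ^ 2 - 1) = ζ ^ 2 by ring, ← hpow ζ, ← hpow ω]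
  field_simp

/-- The order of a Frobenius element `φ` and the value `A₂(a)` are both read off from the symmetry
of the square through which `φ` acts on `(z, w)`. -/
theorem IsDihedralPair.orderOf_frobenius_and_eval_polyA2 (hp : p ≠ 2) {B G : Type*} [CommRing B]
    [Algebra (ZMod p)[X] B] [Group G] [MulSemiringAction G B] [SMulCommClass G (ZMod p)[X] B]
    {z w : B} (h : IsDihedralPair G z w) (hX : (z ^ 2 - 1) ^ 2 = algebraMap (ZMod p)[X] B X)
    {a : ZMod p} (ha0 : a ≠ 0) (ha1 : a ≠ 1) {Q : Ideal B} [Q.IsMaximal]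
    [hQ : Q.LiesOver (Ideal.span {(X - C a : (ZMod p)[X])})] {φ : G}
    (hφ : IsArithFrobAt (ZMod p)[X] φ Q) :
    (orderOf φ = 1 ∧ (polyA2 p).eval a = 1) ∨
    (orderOf φ = 2 ∧ ((polyA2 p).eval a = -1 ∨ (polyA2 p).eval a = 0 ∨
      (polyA2 p).eval a ^ 2 = 1 / (1 - a))) ∨
    (orderOf φ = 4 ∧ (polyA2 p).eval a ^ 2 = a / (1 - a)) := by
  let := Ideal.Quotient.field Q
  let m := Ideal.Quotient.mk Q
  let : Algebra (ZMod p) (B ⧸ Q) := ((m.comp (algebraMap (ZMod p)[X] B)).comp C).toAlgebra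
  have halg (b : ZMod p) : algebraMap (ZMod p) (B ⧸ Q) b = m (algebraMap (ZMod p)[X] B (C b)) := rfl
  have hcard : Nat.card ((ZMod p)[X] ⧸ Q.under (ZMod p)[X]) = p := by
    rw [← hQ.over, Nat.card_congr (quotientSpanXSubCAlgEquiv a).toEquiv, Nat.card_zmod]
  have hfrob (b : B) : m (φ • b) = m b ^ p := by
    have := hφ.mk_apply b
    rwa [hcard] at this
  have hXa : m (algebraMap (ZMod p)[X] B X) = algebraMap (ZMod p) (B ⧸ Q) a := by
    have hmem : X - C a ∈ Q.under (ZMod p)[X] := hQ.over ▸ Ideal.mem_span_singleton_self _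
    rw [halg, ← sub_eq_zero, ← map_sub, ← map_sub, Ideal.Quotient.eq_zero_iff_mem]
    exact hmem
  set ζ := m z with hζ
  set ω := m w with hω
  have hc : ζ ^ 2 + ω ^ 2 = 2 := by
    rw [hζ, hω, ← map_pow, ← map_pow, ← map_add, h.sq_add_sq, map_ofNat]
  have hs : (ζ ^ 2 - 1) ^ 2 = algebraMap (ZMod p) (B ⧸ Q) a := by
    rw [← hXa, ← hX]; simp [hζ]
  have hval := two_mul_mul_polyA2 hp hc hs
  set e := (polyA2 p).eval a
  have hz : ζ ^ p = m (φ • z) := (hfrob z).symm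
  have hw : ω ^ p = m (φ • w) := (hfrob w).symm
  have h2 : (2 : ZMod p) ≠ 0 := ZMod.two_ne_zero_of_ne_two hp
  have h2' : (2 : B ⧸ Q) ≠ 0 := two_ne_zero_of_algebra hp
  have ha1' : 1 - a ≠ 0 := sub_ne_zero.2 ha1.symm
  have hsq : (ζ * ω) ^ 2 = algebraMap (ZMod p) (B ⧸ Q) (1 - a) := by
    rw [map_sub, ← hs, map_one]
    linear_combination ζ ^ 2 * hc
  have hζω : ζ * ω ≠ 0 := by
    rw [← pow_ne_zero_iff two_ne_zero, hsq]
    exact (_root_.map_ne_zero _).2 ha1'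
  have hζ0 : ζ ≠ 0 := left_ne_zero_of_mul hζω
  have hω0 : ω ≠ 0 := right_ne_zero_of_mul hζω
  have hinj := (algebraMap (ZMod p) (B ⧸ Q)).injective
  have hz2 : 2 * z ≠ 0 := fun h0 ↦ mul_ne_zero h2' hζ0 (by
    rw [hζ, ← map_ofNat m 2, ← map_mul, h0, map_zero])
  have hw2 : 2 * w ≠ 0 := fun h0 ↦ mul_ne_zero h2' hω0 (by
    rw [hω, ← map_ofNat m 2, ← map_mul, h0, map_zero])
  have hne1 (h0 : φ • z = -z ∨ φ • w = -w) : φ ≠ 1 := by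
    rintro rfl
    simp only [one_smul] at h0
    exact h0.elim (fun h0 ↦ hz2 (by linear_combination h0)) fun h0 ↦ hw2 (by linear_combination h0)
  -- `z` and `±w` differ, because modulo `Q` their squares differ by `2 * (z ^ 2 - 1) ≠ 0`
  have hne2 (h0 : φ • z = w ∨ φ • z = -w) : φ ≠ 1 := by
    rintro rfl
    simp only [one_smul] at h0
    have hzw : z ^ 2 = w ^ 2 := by rcases h0 with h0 | h0 <;> rw [h0]; ring
    have hζω2 : ζ ^ 2 = ω ^ 2 := by rw [hζ, hω, ← map_pow, hzw, map_pow]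
    have : ζ ^ 2 - 1 = 0 := by
      refine (mul_eq_zero.1 (?_ : 2 * (ζ ^ 2 - 1) = 0)).resolve_left h2'
      linear_combination hc + hζω2
    rw [this, zero_pow two_ne_zero] at hs
    exact ha0 ((map_eq_zero _).1 hs.symm)
  have hsum {c : B ⧸ Q} (hc : 2 * (ζ * ω) * algebraMap (ZMod p) (B ⧸ Q) e = c) :
      algebraMap (ZMod p) (B ⧸ Q) (4 * ((1 - a) * e ^ 2)) = c ^ 2 := by
    rw [← hc, map_mul, map_mul, ← hsq, map_pow, map_ofNat]
    ring
  have h4 : (4 : ZMod p) ≠ 0 := by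
    rw [show (4 : ZMod p) = 2 * 2 by norm_num]; exact mul_ne_zero h2 h2
  -- a reflection of `(z, w)` in a diagonal gives `4 * (1 - a) * e ^ 2 = (ζ ^ 2 + ω ^ 2) ^ 2 = 4`
  have hdiag (hv : 2 * (ζ * ω) * algebraMap (ZMod p) (B ⧸ Q) e = ζ ^ 2 + ω ^ 2 ∨
      2 * (ζ * ω) * algebraMap (ZMod p) (B ⧸ Q) e = -(ζ ^ 2 + ω ^ 2)) :
      e ^ 2 = 1 / (1 - a) := by
    rw [eq_div_iff ha1', mul_comm]
    refine mul_left_cancel₀ h4 (hinj ?_)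
    rcases hv with hv | hv <;> rw [hsum hv, hc, mul_one, map_ofNat] <;> norm_num
  -- a rotation by a right angle gives `4 * (1 - a) * e ^ 2 = (ζ ^ 2 - ω ^ 2) ^ 2 = 4 * a`
  have hrot (hv : 2 * (ζ * ω) * algebraMap (ZMod p) (B ⧸ Q) e = ζ ^ 2 - ω ^ 2 ∨
      2 * (ζ * ω) * algebraMap (ZMod p) (B ⧸ Q) e = -(ζ ^ 2 - ω ^ 2)) :
      e ^ 2 = a / (1 - a) := by
    rw [eq_div_iff ha1', mul_comm]
    refine mul_left_cancel₀ h4 (hinj ?_)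
    have : ζ ^ 2 - ω ^ 2 = 2 * (ζ ^ 2 - 1) := by linear_combination -hc
    rw [this] at hv
    rcases hv with hv | hv <;> rw [hsum hv, map_mul, ← hs, map_ofNat] <;> ring
  have h2ζω : 2 * (ζ * ω) ≠ 0 := mul_ne_zero h2' hζω
  rcases h.smul_cases φ with ⟨hz1 | hz1, hw1 | hw1⟩ | ⟨hz1 | hz1, hw1 | hw1⟩ <;>
    rw [hz, hw, hz1, hw1] at hval <;> simp only [map_neg, ← hζ, ← hω] at hval
  · refine .inl ⟨orderOf_eq_one_iff.2 (h.eq_one φ hz1 hw1), hinj (mul_left_cancel₀ h2ζω ?_)⟩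
    rw [hval, map_one]; ring
  · refine .inr (.inl ⟨h.orderOf_eq_two (hne1 (.inr hw1)) ?_ ?_, .inr (.inl ?_)⟩)
    · simp [hz1]
    · simp [hw1]
    · refine hinj (mul_left_cancel₀ h2ζω ?_)
      rw [hval, map_zero]; ring
  · refine .inr (.inl ⟨h.orderOf_eq_two (hne1 (.inl hz1)) ?_ ?_, .inr (.inl ?_)⟩)
    · simp [hz1]
    · simp [hw1]
    · refine hinj (mul_left_cancel₀ h2ζω ?_)
      rw [hval, map_zero]; ring
  · refine .inr (.inl ⟨h.orderOf_eq_two (hne1 (.inl hz1)) ?_ ?_, .inl ?_⟩)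
    · simp [hz1]
    · simp [hw1]
    · refine hinj (mul_left_cancel₀ h2ζω ?_)
      rw [hval, map_neg, map_one]; ring
  · refine .inr (.inl ⟨h.orderOf_eq_two (hne2 (.inl hz1)) ?_ ?_, .inr (.inr (hdiag (.inl ?_)))⟩)
    · simp [hz1, hw1]
    · simp [hz1, hw1]
    · rw [hval]; ring
  · refine .inr (.inr ⟨h.orderOf_eq_four hz2 (.inl ⟨hz1, hw1⟩), hrot (.inr ?_)⟩)
    rw [hval]; ring
  · refine .inr (.inr ⟨h.orderOf_eq_four hz2 (.inr ⟨hz1, hw1⟩), hrot (.inl ?_)⟩)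
    rw [hval]; ring
  · refine .inr (.inl ⟨h.orderOf_eq_two (hne2 (.inr hz1)) ?_ ?_, .inr (.inr (hdiag (.inr ?_)))⟩)
    · simp [hz1, hw1]
    · simp [hz1, hw1]
    · rw [hval]; ring

theorem IsDihedralPair.inertia_eq_bot_of_liesOver (hp : p ≠ 2) {B G : Type*} [CommRing B]
    [Algebra (ZMod p)[X] B] [Group G] [MulSemiringAction G B]
    {z w : B} (h : IsDihedralPair G z w) (hX : (z ^ 2 - 1) ^ 2 = algebraMap (ZMod p)[X] B X)
    {a : ZMod p} (ha0 : a ≠ 0) (ha1 : a ≠ 1) {Q : Ideal B} [hprime : Q.IsPrime]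
    [hQ : Q.LiesOver (Ideal.span {(X - C a : (ZMod p)[X])})] : Q.inertia G = ⊥ := by
  have hmem : algebraMap (ZMod p)[X] B (X - C a) ∈ Q := by
    have hmem : X - C a ∈ Q.under (ZMod p)[X] := hQ.over ▸ Ideal.mem_span_singleton_self _
    exact hmem
  have hunit {c : ZMod p} (hc : c ≠ 0) : algebraMap (ZMod p)[X] B (C c) ∉ Q := fun hcQ ↦
    hprime.ne_top (Q.eq_top_of_isUnit_mem hcQ ((hc.isUnit.map C).map _))
  have h2 : (2 : B) ∉ Q := by
    have := hunit (ZMod.two_ne_zero_of_ne_two hp)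
    rwa [map_ofNat, map_ofNat] at this
  refine h.inertia_eq_bot h2 (fun hzw ↦ ?_) fun hsub ↦ ?_
  · refine hunit (sub_ne_zero.2 ha1.symm) ?_
    have : algebraMap (ZMod p)[X] B (C (1 - a)) =
        z * w * (z * w) + algebraMap (ZMod p)[X] B (X - C a) := by
      simp only [map_sub, map_one, ← hX]
      linear_combination -z ^ 2 * h.sq_add_sq
    exact this ▸ Q.add_mem (Q.mul_mem_left _ hzw) hmem
  · have hx : 2 * (z ^ 2 - 1) ∈ Q := by
      convert hsub using 1
      linear_combination h.sq_add_sq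
    refine hunit ha0 ?_
    have : algebraMap (ZMod p)[X] B (C a) =
        (z ^ 2 - 1) * (z ^ 2 - 1) - algebraMap (ZMod p)[X] B (X - C a) := by
      simp only [map_sub, ← hX]
      ring
    exact this ▸ Q.sub_mem (Q.mul_mem_left _ ((hprime.mem_or_mem hx).resolve_left h2)) hmem

/-- The number of primes above `(t - a)` is the order of the group divided by the order of
Frobenius, and the latter is tied to the value `A₂(a)`. -/
theorem IsDihedralPair.exists_ncard_primesOver_mul_eq_card (hp : p ≠ 2) {B G : Type*} [CommRing B]
    [Algebra (ZMod p)[X] B] [FaithfulSMul (ZMod p)[X] B] [Module.Finite (ZMod p)[X] B]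
    [Group G] [Finite G] [MulSemiringAction G B] [SMulCommClass G (ZMod p)[X] B]
    [Algebra.IsInvariant (ZMod p)[X] B G] {z w : B} (h : IsDihedralPair G z w)
    (hX : (z ^ 2 - 1) ^ 2 = algebraMap (ZMod p)[X] B X) {a : ZMod p} (ha0 : a ≠ 0) (ha1 : a ≠ 1) :
    ∃ f, (Ideal.primesOver (Ideal.span {(X - C a : (ZMod p)[X])}) B).ncard * f = Nat.card G ∧
      ((f = 1 ∧ (polyA2 p).eval a = 1) ∨
      (f = 2 ∧ ((polyA2 p).eval a = -1 ∨ (polyA2 p).eval a = 0 ∨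
        (polyA2 p).eval a ^ 2 = 1 / (1 - a))) ∨
      (f = 4 ∧ (polyA2 p).eval a ^ 2 = a / (1 - a))) := by
  set P : Ideal (ZMod p)[X] := Ideal.span {X - C a}
  have hPquot : Finite ((ZMod p)[X] ⧸ P) :=
    .of_equiv _ (quotientSpanXSubCAlgEquiv a).symm.toEquiv
  have hPmax : P.IsMaximal :=
    PrincipalIdealRing.isMaximal_of_irreducible (irreducible_X_sub_C a)
  obtain ⟨Q, hQmax, hQP⟩ := Ideal.exists_maximal_ideal_liesOver_of_isIntegral (S := B) P
  have : Finite (B ⧸ Q) := Module.finite_of_finite ((ZMod p)[X] ⧸ P)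
  obtain ⟨φ, hφ⟩ := IsArithFrobAt.exists_of_isInvariant (ZMod p)[X] G Q
  exact ⟨orderOf φ, hφ.ncard_primesOver_mul_orderOf P (h.inertia_eq_bot_of_liesOver hp hX ha0 ha1),
    h.orderOf_frobenius_and_eval_polyA2 hp hX ha0 ha1 hφ⟩

end FrobeniusValue

/-! ### The dihedral extension generated by a point of the circle -/

section DihedralExtension

/-- The polynomial `(X² - 1)² - t`. If `x² = t`, its roots are `±√(1 + x)` and `±√(1 - x)`. -/
noncomputable def dihedralQuartic {K : Type*} [Field K] (t : K) : K[X] :=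
  (X ^ 2 - 1) ^ 2 - C t

variable {K L : Type*} [Field K] [Field L] [Algebra K L] {t : K} {z w : L}

theorem separable_dihedralQuartic (h2 : (2 : K) ≠ 0) (h0 : t ≠ 0) (h1 : t ≠ 1) :
    (dihedralQuartic t).Separable := by
  have hd : derivative (dihedralQuartic t) = C 4 * (X * (X ^ 2 - 1)) := by
    simp only [dihedralQuartic, derivative_sub, derivative_pow, derivative_C, derivative_X,
      derivative_one, map_ofNat]
    push_cast
    simp only [map_ofNat]
    ring
  rw [separable_def, hd]
  have hC {c : K} (hc : c ≠ 0) : C c⁻¹ * C c = 1 := by rw [← C_mul, inv_mul_cancel₀ hc, C_1]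
  refine .mul_right ?_ (.mul_right ?_ ?_)
  · refine isCoprime_one_right.of_isCoprime_of_dvd_right (IsUnit.dvd ?_)
    refine (IsUnit.mk0 (4 : K) ?_).map C
    rw [show (4 : K) = 2 * 2 by norm_num]
    exact mul_ne_zero h2 h2
  · refine ⟨C (1 - t)⁻¹, -C (1 - t)⁻¹ * (X ^ 3 - 2 * X), ?_⟩
    have h := hC (sub_ne_zero.2 h1.symm)
    rw [dihedralQuartic]
    simp only [map_sub, map_one] at h ⊢
    linear_combination h
  · refine ⟨-C t⁻¹, C t⁻¹ * (X ^ 2 - 1), ?_⟩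
    rw [dihedralQuartic]
    linear_combination hC h0

theorem map_dihedralQuartic (h : z ^ 2 + w ^ 2 = 2) (ht : (z ^ 2 - 1) ^ 2 = algebraMap K L t) :
    (dihedralQuartic t).map (algebraMap K L) =
      (X - C z) * (X - C (-z)) * (X - C w) * (X - C (-w)) := by
  have h' := congrArg C h
  have ht' := congrArg C ht
  simp only [map_add, map_pow, map_sub, map_one, map_ofNat] at h' ht'
  simp only [dihedralQuartic, Polynomial.map_sub, Polynomial.map_pow, map_X, Polynomial.map_one,
    map_C, C_neg]
  linear_combination (X ^ 2 - C z ^ 2) * h' + ht'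

theorem splits_map_dihedralQuartic (h : z ^ 2 + w ^ 2 = 2)
    (ht : (z ^ 2 - 1) ^ 2 = algebraMap K L t) :
    ((dihedralQuartic t).map (algebraMap K L)).Splits := by
  rw [map_dihedralQuartic h ht]
  exact (((Splits.X_sub_C _).mul (.X_sub_C _)).mul (.X_sub_C _)).mul (.X_sub_C _)

theorem rootSet_dihedralQuartic (h : z ^ 2 + w ^ 2 = 2)
    (ht : (z ^ 2 - 1) ^ 2 = algebraMap K L t) :
    (dihedralQuartic t).rootSet L = {z, -z, w, -w} := by
  have hne : (dihedralQuartic t).map (algebraMap K L) ≠ 0 := by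
    rw [map_dihedralQuartic h ht]
    simp [X_sub_C_ne_zero, -map_neg]
  ext r
  rw [mem_rootSet', ← eval_map_algebraMap, and_iff_right hne, map_dihedralQuartic h ht]
  simp [sub_eq_zero, add_eq_zero_iff_eq_neg, or_assoc]

/-- Conjugates of `z` are roots of `dihedralQuartic t`, and the relation `z² + w² = 2` then
restricts those of `w`. -/
theorem isDihedralPair_of_isSplittingField [IsSplittingField K L (dihedralQuartic t)]
    (h : z ^ 2 + w ^ 2 = 2) (ht : (z ^ 2 - 1) ^ 2 = algebraMap K L t) :
    IsDihedralPair Gal(L/K) z w where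
  sq_add_sq := h
  smul_cases σ := by
    have hσ : (σ z) ^ 2 + (σ w) ^ 2 = 2 := by
      rw [← map_pow, ← map_pow, ← map_add, h, map_ofNat]
    have hx : (σ z ^ 2 - 1) ^ 2 = (z ^ 2 - 1) ^ 2 := by
      rw [ht, ← σ.commutes, ← ht]; simp
    simp only [AlgEquiv.smul_def, ← sq_eq_sq_iff_eq_or_eq_neg]
    rcases sq_eq_sq_iff_eq_or_eq_neg.1 hx with hx | hx
    · exact .inl ⟨by linear_combination hx, by linear_combination hσ - h - hx⟩
    · exact .inr ⟨by linear_combination hx - h, by linear_combination hσ - hx⟩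
  eq_one σ hz hw := by
    have hz : σ z = z := hz
    have hw : σ w = w := hw
    have : (σ : L →ₐ[K] L) = AlgHom.id K L := by
      refine AlgHom.ext_of_adjoin_eq_top (IsSplittingField.adjoin_rootSet L (dihedralQuartic t))
        fun r hr ↦ ?_
      rw [rootSet_dihedralQuartic h ht] at hr
      rcases hr with rfl | rfl | rfl | rfl <;> simp [hz, hw]
    exact AlgEquiv.ext fun r ↦ DFunLike.congr_fun this r

/-- By Galois theory, the three elements of square `t`, `1 - t` and `t * (1 - t)` are moved by
some automorphism. -/
theorem card_gal_of_isSplittingField [IsSplittingField K L (dihedralQuartic t)]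
    (h : z ^ 2 + w ^ 2 = 2) (ht : (z ^ 2 - 1) ^ 2 = algebraMap K L t) (h2 : (2 : K) ≠ 0)
    (h0 : ¬ IsSquare t) (h1 : ¬ IsSquare (1 - t)) (h01 : ¬ IsSquare (t * (1 - t))) :
    Nat.card Gal(L/K) = 8 := by
  have ht0 : t ≠ 0 := by rintro rfl; exact h0 .zero
  have ht1 : t ≠ 1 := by rintro rfl; exact h0 .one
  have := IsGalois.of_separable_splitting_field (E := L) (separable_dihedralQuartic h2 ht0 ht1)
  have := IsSplittingField.finiteDimensional L (dihedralQuartic t)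
  have hy : (z * w) ^ 2 = algebraMap K L (1 - t) := by
    rw [map_sub, map_one, ← ht]
    linear_combination z ^ 2 * h
  have hzw : z * w ≠ 0 := by
    rw [← pow_ne_zero_iff two_ne_zero, hy]
    exact (_root_.map_ne_zero _).2 (sub_ne_zero.2 ht1.symm)
  have hmoved {u : L} {s : K} (hu : u ^ 2 = algebraMap K L s) (hs : ¬ IsSquare s) :
      ∃ σ : Gal(L/K), σ • u ≠ u := by
    by_contra! hfix
    obtain ⟨r, rfl⟩ := IntermediateField.mem_bot.1 ((IsGalois.mem_bot_iff_fixed u).2 hfix)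
    exact hs ⟨r, (algebraMap K L).injective (by rw [← hu, map_mul, pow_two])⟩
  refine (isDihedralPair_of_isSplittingField h ht).card_eq_eight ?_ (left_ne_zero_of_mul hzw)
    (right_ne_zero_of_mul hzw) (hmoved ht h0) (hmoved hy h1) (hmoved (s := t * (1 - t)) ?_ h01)
  · rw [← map_ofNat (algebraMap K L) 2]
    exact (_root_.map_ne_zero _).2 h2
  · rw [mul_pow, ht, hy, map_mul]

end DihedralExtension

/-- Squarefree nonconstant polynomials are not squares of rational functions. -/
theorem Polynomial.not_isSquare_algebraMap_ratFunc {k : Type*} [Field k] {f : k[X]}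
    (hf : Squarefree f) (hu : ¬ IsUnit f) : ¬ IsSquare (algebraMap k[X] (RatFunc k) f) := by
  rintro ⟨r, hr⟩
  have hint : IsIntegral k[X] r := by
    refine .of_pow two_pos ?_
    rw [pow_two, ← hr]
    exact isIntegral_algebraMap
  obtain ⟨g, rfl⟩ := IsIntegrallyClosed.isIntegral_iff.1 hint
  rw [← map_mul, (IsFractionRing.injective k[X] (RatFunc k)).eq_iff] at hr
  have := hf g (hr ▸ dvd_rfl)
  exact hu (hr ▸ this.mul this)

/-! ### Counting primes -/

/-- If `x`, `y`, `z` are the three square roots, then `w = y / z` is a square root of `1 - x`, and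
the field they generate is the splitting field of `(X² - 1)² - t`, with roots `±z` and `±w`. -/
theorem exists_isSplittingField_heisenbergField {k : Type*} [Field k]
    {x y z : AlgebraicClosure (RatFunc k)} (h : IsHeisenbergRoots k 2 (-1) x y z) :
    IsSplittingField (RatFunc k) (heisenbergField k x y z) (dihedralQuartic (RatFunc.X : RatFunc k))
      ∧ ∃ z' w' : heisenbergField k x y z, z' ^ 2 + w' ^ 2 = 2 ∧
        (z' ^ 2 - 1) ^ 2 = algebraMap (RatFunc k) _ RatFunc.X := by
  have hz2 : z ^ 2 = 1 + x := by
    rw [h.pow_z]; simp [heisenbergEps]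
  have hz0 : z ≠ 0 := by
    rintro rfl
    have hx : x = -1 := by linear_combination -hz2
    have hX := h.pow_x
    rw [hx, neg_one_sq, ← map_one (algebraMap (RatFunc k) _)] at hX
    have hX := (algebraMap (RatFunc k) (AlgebraicClosure (RatFunc k))).injective hX
    rw [← RatFunc.algebraMap_X, ← map_one (algebraMap k[X] (RatFunc k))] at hX
    exact X_ne_C (1 : k) (IsFractionRing.injective k[X] (RatFunc k) hX).symm
  have hw2 : (y / z) ^ 2 = 1 - x := by
    rw [div_pow, div_eq_iff (pow_ne_zero 2 hz0), h.pow_y, ← h.pow_x, hz2]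
    ring
  have hc : z ^ 2 + (y / z) ^ 2 = 2 := by rw [hz2, hw2]; ring
  have ht : (z ^ 2 - 1) ^ 2 = algebraMap (RatFunc k) _ RatFunc.X := by
    rw [← h.pow_x, hz2]; ring
  have hz : z ∈ heisenbergField k x y z :=
    IntermediateField.subset_adjoin _ _ (by simp)
  have hw : y / z ∈ heisenbergField k x y z :=
    div_mem (IntermediateField.subset_adjoin _ _ (by simp)) hz
  have hc' : (⟨z, hz⟩ : heisenbergField k x y z) ^ 2 + ⟨y / z, hw⟩ ^ 2 = 2 := Subtype.ext hc
  have ht' : ((⟨z, hz⟩ : heisenbergField k x y z) ^ 2 - 1) ^ 2 =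
      algebraMap (RatFunc k) _ RatFunc.X := Subtype.ext ht
  refine ⟨IntermediateField.isSplittingField_iff.2 ⟨splits_map_dihedralQuartic hc' ht', ?_⟩,
    ⟨z, hz⟩, ⟨y / z, hw⟩, hc', ht'⟩
  rw [rootSet_dihedralQuartic hc ht]
  apply le_antisymm
  · refine IntermediateField.adjoin_le_iff.2 ?_
    have hzm : z ∈ IntermediateField.adjoin (RatFunc k) {z, -z, y / z, -(y / z)} :=
      IntermediateField.subset_adjoin _ _ (by simp)
    have hwm : y / z ∈ IntermediateField.adjoin (RatFunc k) {z, -z, y / z, -(y / z)} :=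
      IntermediateField.subset_adjoin _ _ (by simp)
    rintro r (rfl | rfl | rfl)
    · rw [show r = z ^ 2 - 1 by rw [hz2]; ring]
      exact sub_mem (pow_mem hzm 2) (one_mem _)
    · have := mul_mem hwm hzm
      rwa [div_mul_cancel₀ _ hz0] at this
    · exact hzm
  · refine IntermediateField.adjoin_le_iff.2 ?_
    rintro r (rfl | rfl | rfl | rfl)
    exacts [hz, neg_mem hz, hw, neg_mem hw]

/-- The Galois group has order eight because the square classes of `t` and `1 - t` are
independent. -/
theorem card_gal_heisenbergField {p : ℕ} [Fact p.Prime] (hp : p ≠ 2)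
    {x y z : AlgebraicClosure (RatFunc (ZMod p))}
    (h : IsHeisenbergRoots (ZMod p) 2 (-1) x y z) :
    Nat.card Gal(heisenbergField (ZMod p) x y z/RatFunc (ZMod p)) = 8 := by
  obtain ⟨_, z', w', hc, ht⟩ := exists_isSplittingField_heisenbergField h
  have hX : Irreducible (X : (ZMod p)[X]) := irreducible_X
  have h1X : Irreducible (1 - X : (ZMod p)[X]) := by
    have := (Associated.refl (X - C 1 : (ZMod p)[X])).neg_left.irreducible_iff.2
      (irreducible_X_sub_C 1)
    rwa [neg_sub, C_1] at this
  have hcop : IsCoprime (X : (ZMod p)[X]) (1 - X) := ⟨1, 1, by ring⟩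
  have hmap : (1 - RatFunc.X : RatFunc (ZMod p)) = algebraMap (ZMod p)[X] _ (1 - X) := by
    rw [map_sub, map_one, RatFunc.algebraMap_X]
  refine card_gal_of_isSplittingField hc ht (two_ne_zero_of_algebra hp) ?_ ?_ ?_
  · rw [← RatFunc.algebraMap_X]
    exact not_isSquare_algebraMap_ratFunc hX.squarefree hX.not_isUnit
  · rw [hmap]
    exact not_isSquare_algebraMap_ratFunc h1X.squarefree h1X.not_isUnit
  · rw [hmap, ← RatFunc.algebraMap_X, ← map_mul]
    exact not_isSquare_algebraMap_ratFunc
      (squarefree_mul_iff.2 ⟨hcop.isRelPrime, hX.squarefree, h1X.squarefree⟩)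
      fun hu ↦ hX.not_isUnit (isUnit_of_mul_isUnit_left hu)

theorem exists_numPrimesAbove_mul_eq_card_gal {p : ℕ} [Fact p.Prime] (hp : p ≠ 2) {a : ZMod p}
    (ha0 : a ≠ 0) (ha1 : a ≠ 1)
    (R : IntermediateField (RatFunc (ZMod p)) (AlgebraicClosure (RatFunc (ZMod p))))
    [IsSplittingField (RatFunc (ZMod p)) R (dihedralQuartic (RatFunc.X : RatFunc (ZMod p)))]
    {z w : R} (hc : z ^ 2 + w ^ 2 = 2)
    (ht : (z ^ 2 - 1) ^ 2 = algebraMap (RatFunc (ZMod p)) R RatFunc.X) :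
    ∃ f, numPrimesAbove R a * f = Nat.card Gal(R/RatFunc (ZMod p)) ∧
      ((f = 1 ∧ (polyA2 p).eval a = 1) ∨
      (f = 2 ∧ ((polyA2 p).eval a = -1 ∨ (polyA2 p).eval a = 0 ∨
        (polyA2 p).eval a ^ 2 = 1 / (1 - a))) ∨
      (f = 4 ∧ (polyA2 p).eval a ^ 2 = a / (1 - a))) := by
  let K := RatFunc (ZMod p)
  let B := integralClosure (ZMod p)[X] R
  have hX1 : (RatFunc.X : K) ≠ 1 := by
    rw [← RatFunc.algebraMap_X, ← map_one (algebraMap (ZMod p)[X] K)]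
    exact fun h ↦ X_ne_C (1 : ZMod p) (IsFractionRing.injective (ZMod p)[X] K h)
  have : IsGalois K R :=
    .of_separable_splitting_field
      (separable_dihedralQuartic (two_ne_zero_of_algebra hp) RatFunc.X_ne_zero hX1)
  have : FiniteDimensional K R :=
    IsSplittingField.finiteDimensional R (dihedralQuartic (RatFunc.X : RatFunc (ZMod p)))
  have : Module.Finite (ZMod p)[X] B := IsIntegralClosure.finite (ZMod p)[X] K R B
  have : IsFractionRing B R := integralClosure.isFractionRing_of_finite_extension K R
  have : IsGaloisGroup Gal(R/K) (ZMod p)[X] B := .of_isFractionRing Gal(R/K) (ZMod p)[X] B K R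
  have htX : (z ^ 2 - 1) ^ 2 = algebraMap (ZMod p)[X] R X := by
    rw [ht, IsScalarTower.algebraMap_apply (ZMod p)[X] K R, RatFunc.algebraMap_X]
  have hz : IsIntegral (ZMod p)[X] z := by
    have h1 : IsIntegral (ZMod p)[X] (z ^ 2 - 1) :=
      .of_pow two_pos (htX ▸ isIntegral_algebraMap)
    refine .of_pow two_pos ?_
    simpa using h1.add isIntegral_one
  have hw : IsIntegral (ZMod p)[X] w := by
    refine .of_pow two_pos ?_
    rw [show w ^ 2 = 1 + 1 - z ^ 2 by linear_combination hc]
    exact (isIntegral_one.add isIntegral_one).sub (hz.pow 2)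
  have hpair := isDihedralPair_of_isSplittingField hc ht
  have hpairB : IsDihedralPair Gal(R/K) (⟨z, hz⟩ : B) ⟨w, hw⟩ := by
    refine ⟨Subtype.ext hc, fun σ ↦ ?_, fun σ h1 h2 ↦ hpair.eq_one σ ?_ ?_⟩
    · have := hpair.smul_cases σ
      refine Or.imp (And.imp (Or.imp ?_ ?_) (Or.imp ?_ ?_))
        (And.imp (Or.imp ?_ ?_) (Or.imp ?_ ?_)) this <;> exact fun h ↦ Subtype.ext h
    · exact congrArg Subtype.val h1
    · exact congrArg Subtype.val h2
  have hinj : Function.Injective (algebraMap (ZMod p)[X] R) := by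
    rw [IsScalarTower.algebraMap_eq (ZMod p)[X] K R]
    exact (algebraMap K R).injective.comp (IsFractionRing.injective (ZMod p)[X] K)
  have : FaithfulSMul (ZMod p)[X] B := (faithfulSMul_iff_algebraMap_injective _ _).2
    (Function.Injective.of_comp (f := Subtype.val) hinj)
  exact hpairB.exists_ncard_primesOver_mul_eq_card hp (Subtype.ext htX) ha0 ha1

theorem mainTheorem2 (p : ℕ) [Fact p.Prime] (hp : p ≠ 2) (a : ZMod p)
    (ha0 : a ≠ 0) (ha1 : a ≠ 1) (ha2 : a ≠ 1 / 2)
    (x y z : AlgebraicClosure (RatFunc (ZMod p)))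
    (hxyz : IsHeisenbergRoots (ZMod p) 2 (-1) x y z) :
    ((polyA2 p).eval a = 1 →
      numPrimesAbove (heisenbergField (ZMod p) x y z) a = 8) ∧
    (((polyA2 p).eval a = -1 ∨ (polyA2 p).eval a = 0 ∨ (polyA2 p).eval a ^ 2 = 1 / (1 - a)) →
      numPrimesAbove (heisenbergField (ZMod p) x y z) a = 4) ∧
    ((polyA2 p).eval a ^ 2 = a / (1 - a) →
      numPrimesAbove (heisenbergField (ZMod p) x y z) a = 2) ∧
    ((polyA2 p).eval a = 1 ∨
      ((polyA2 p).eval a = -1 ∨ (polyA2 p).eval a = 0 ∨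
        (polyA2 p).eval a ^ 2 = 1 / (1 - a)) ∨
      (polyA2 p).eval a ^ 2 = a / (1 - a)) := by
  obtain ⟨_, z', w', hc, ht⟩ := exists_isSplittingField_heisenbergField hxyz
  obtain ⟨f, hf, hcases⟩ := exists_numPrimesAbove_mul_eq_card_gal hp ha0 ha1 _ hc ht
  rw [card_gal_heisenbergField hp hxyz] at hf
  have h2 : (2 : ZMod p) ≠ 0 := ZMod.two_ne_zero_of_ne_two hp
  have ha1' : 1 - a ≠ 0 := sub_ne_zero.2 ha1.symm
  have ha2' : 2 * a ≠ 1 := fun h ↦ ha2 (by rw [eq_div_iff h2, mul_comm, h])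
  generalize numPrimesAbove (heisenbergField (ZMod p) x y z) a = n at *
  generalize (polyA2 p).eval a = e at *
  -- the three values of `f` belong to disjoint conditions on `e`
  have h12 (h1 : e = 1) : ¬ (e = -1 ∨ e = 0 ∨ e ^ 2 = 1 / (1 - a)) := by
    subst h1
    rintro (h | h | h)
    · exact h2 (by linear_combination h)
    · exact one_ne_zero h
    · rw [eq_div_iff ha1'] at h
      exact ha0 (by linear_combination -h)
  have h14 (h1 : e = 1) : ¬ e ^ 2 = a / (1 - a) := by
    subst h1
    rw [eq_div_iff ha1']
    exact fun h ↦ ha2' (by linear_combination -h)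
  have h24 (h1 : e = -1 ∨ e = 0 ∨ e ^ 2 = 1 / (1 - a)) : ¬ e ^ 2 = a / (1 - a) := by
    rw [eq_div_iff ha1']
    intro h
    rcases h1 with rfl | rfl | h1
    · exact ha2' (by linear_combination -h)
    · exact ha0 (by linear_combination -h)
    · rw [eq_div_iff ha1'] at h1
      exact ha1 (by linear_combination h1 - h)
  rcases hcases with ⟨rfl, h⟩ | ⟨rfl, h⟩ | ⟨rfl, h⟩
  · exact ⟨fun _ ↦ by omega, fun h' ↦ absurd h' (h12 h), fun h' ↦ absurd h' (h14 h), .inl h⟩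
  · exact ⟨fun h' ↦ absurd h (h12 h'), fun _ ↦ by omega, fun h' ↦ absurd h' (h24 h),
      .inr (.inl h)⟩
  · exact ⟨fun h' ↦ absurd h (h14 h'), fun h' ↦ absurd h (h24 h'), fun _ ↦ by omega,
      .inr (.inr h)⟩
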